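/- Let $H$ be the simply connected three-dimensional Heisenberg group, with Lie algebra $\mathfrak h=\operatorname{span}\{X,Y,Z\}$, $[X,Y]=Z$, $Z$ central. Endow $H$ with a left-invariant Riemannian metric $g$ and with an exact left-invariant magnetic form $\Omega=d\theta$, where $\theta$ is a left-invariant $1$-form, and set $|B|=|\theta(Z)|/|Z|_g$ (so $\Omega=d(B\zeta)$ with $\zeta$ a left-invariant $1$-form of norm $1$ vanishing on the $g$-orthogonal complement of the centre). For a discrete cocompact subgroup $\Gamma<H$, give $\Gamma\backslash H$ the induced metric and magnetic form. A magnetic geodesic is a smooth curve $\sigma$ with $\nabla_{\dot\sigma}\dot\sigma=F\dot\sigma$, where $\Omega(u,v)=g(Fu,v)$; its energy is the constant $|\dot\sigma|$. For a free homotopy class $\mathcal C$ of closed curves on $\Gamma\backslash H$ and $E>|B|$, let $L(\mathcal C;E)$ be the set of lengths $E|\omega|$, where $\sigma$ is a magnetic geodesic of energy $E$ on $\Gamma\backslash H$, $\omega\neq0$, $\sigma(t+\omega)=\sigma(t)$ for all $t$, and the closed curve $s\mapsto\sigma(s\omega)$, $0\le s\le 1$, belongs to $\mathcal C$. Let $\Gamma_1,\Gamma_2<H$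 be discrete cocompact subgroups. Suppose that for some $E>|B|$ the manifolds $\Gamma_1\backslash H$ and $\Gamma_2\backslash H$ have the same marked magnetic length spectrum at energy $E$, i.e. there is an isomorphism $\phi:\Gamma_1\to\Gamma_2$ such that $L(\phi_*\mathcal C;E)=L(\mathcal C;E)$ for every nontrivial free homotopy class $\mathcal C$ of closed curves on $\Gamma_1\backslash H$, where $\phi_*$ is the induced bijection of free homotopy classes (conjugacy classes of $\Gamma_i\cong\pi_1(\Gamma_i\backslash H)$). Then $\Gamma_1\backslash H$ and $\Gamma_2\backslash H$ are isometric Riemannian manifolds. -/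

import Mathlib

open scoped Manifold ContDiff Topology

noncomputable section

/-- The simply connected three-dimensional Heisenberg group `H`, in exponential coordinates: the
triple `(x, y, z)` stands for `exp (x X + y Y + z Z)`. Since `exp` is a diffeomorphism, the same
triples are also used for the elements of the Lie algebra `𝔥`, with basis `X, Y, Z`. The norm is
used only for the topology and the smooth structure. -/
def Heis : Type := ℝ × ℝ × ℝ

namespace Heis

instance : NormedAddCommGroup Heis := inferInstanceAs (NormedAddCommGroup (ℝ × ℝ × ℝ))
instance : NormedSpace ℝ Heis := inferInstanceAs (NormedSpace ℝ (ℝ × ℝ × ℝ))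
instance : FiniteDimensional ℝ Heis := inferInstanceAs (FiniteDimensional ℝ (ℝ × ℝ × ℝ))

/-- The central basis vector `Z` of the Lie algebra. -/
def Z : Heis := ((0, 0, 1) : ℝ × ℝ × ℝ)

/-- The Lie bracket of the Heisenberg algebra: `[X, Y] = Z`, and `Z` is central. -/
def bracket (u v : Heis) : Heis := ((0, 0, u.1 * v.2.1 - u.2.1 * v.1) : ℝ × ℝ × ℝ)

/-- The group law `exp U * exp V = exp (U + V + [U, V] / 2)`. -/
instance : Mul Heis := ⟨fun p q => p + q + (1 / 2 : ℝ) • bracket p q⟩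
instance : One Heis := ⟨(0 : Heis)⟩
instance : Inv Heis := ⟨fun p => -p⟩

theorem mul_def (p q : Heis) : p * q = p + q + (1 / 2 : ℝ) • bracket p q := rfl
theorem one_def : (1 : Heis) = 0 := rfl
theorem inv_def (p : Heis) : p⁻¹ = -p := rfl

@[ext] theorem ext {p q : Heis} (h1 : p.1 = q.1) (h2 : p.2.1 = q.2.1) (h3 : p.2.2 = q.2.2) :
    p = q := Prod.ext h1 (Prod.ext h2 h3)

@[simp] theorem add_fst (p q : Heis) : (p + q).1 = p.1 + q.1 := rfl
@[simp] theorem add_snd (p q : Heis) : (p + q).2.1 = p.2.1 + q.2.1 := rfl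
@[simp] theorem add_trd (p q : Heis) : (p + q).2.2 = p.2.2 + q.2.2 := rfl
@[simp] theorem neg_fst (p : Heis) : (-p).1 = -p.1 := rfl
@[simp] theorem neg_snd (p : Heis) : (-p).2.1 = -p.2.1 := rfl
@[simp] theorem neg_trd (p : Heis) : (-p).2.2 = -p.2.2 := rfl
@[simp] theorem smul_fst (a : ℝ) (p : Heis) : (a • p).1 = a * p.1 := rfl
@[simp] theorem smul_snd (a : ℝ) (p : Heis) : (a • p).2.1 = a * p.2.1 := rfl
@[simp] theorem smul_trd (a : ℝ) (p : Heis) : (a • p).2.2 = a * p.2.2 := rfl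
@[simp] theorem zero_fst : (0 : Heis).1 = 0 := rfl
@[simp] theorem zero_snd : (0 : Heis).2.1 = 0 := rfl
@[simp] theorem zero_trd : (0 : Heis).2.2 = 0 := rfl
@[simp] theorem bracket_fst (p q : Heis) : (bracket p q).1 = 0 := rfl
@[simp] theorem bracket_snd (p q : Heis) : (bracket p q).2.1 = 0 := rfl
@[simp] theorem bracket_trd (p q : Heis) :
    (bracket p q).2.2 = p.1 * q.2.1 - p.2.1 * q.1 := rfl

instance : Group Heis where
  mul_assoc a b c := by ext <;> simp [mul_def] <;> ring
  one_mul a := by ext <;> simp [mul_def, one_def]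
  mul_one a := by ext <;> simp [mul_def, one_def]
  inv_mul_cancel a := by
    ext
    · simp [mul_def, one_def, inv_def]
    · simp [mul_def, one_def, inv_def]
    · simp [mul_def, one_def, inv_def]; ring

@[simp] theorem Z_fst : Z.1 = 0 := rfl
@[simp] theorem Z_snd : Z.2.1 = 0 := rfl
@[simp] theorem Z_trd : Z.2.2 = 1 := rfl

theorem contDiff_fst : ContDiff ℝ ∞ (fun p : Heis => p.1) :=
  (_root_.contDiff_fst : ContDiff ℝ ∞ (Prod.fst : ℝ × ℝ × ℝ → ℝ))
theorem contDiff_snd : ContDiff ℝ ∞ (fun p : Heis => p.2.1) :=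
  (_root_.contDiff_fst.comp _root_.contDiff_snd :
    ContDiff ℝ ∞ (fun p : ℝ × ℝ × ℝ => p.2.1))

theorem contDiff_bracket : ContDiff ℝ ∞ (fun p : Heis × Heis => bracket p.1 p.2) := by
  have h1 : ContDiff ℝ ∞ (fun p : Heis × Heis => p.1.1) := contDiff_fst.comp _root_.contDiff_fst
  have h2 : ContDiff ℝ ∞ (fun p : Heis × Heis => p.1.2.1) := contDiff_snd.comp _root_.contDiff_fst
  have h3 : ContDiff ℝ ∞ (fun p : Heis × Heis => p.2.1) := contDiff_fst.comp _root_.contDiff_snd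
  have h4 : ContDiff ℝ ∞ (fun p : Heis × Heis => p.2.2.1) := contDiff_snd.comp _root_.contDiff_snd
  have h5 : ContDiff ℝ ∞ (fun p : Heis × Heis => (p.1.1 * p.2.2.1 - p.1.2.1 * p.2.1) • Z) :=
    ((h1.mul h4).sub (h2.mul h3)).smul contDiff_const
  convert h5 using 2 with p
  ext <;> simp

theorem contDiff_mul : ContDiff ℝ ∞ (fun p : Heis × Heis => p.1 * p.2) :=
  (_root_.contDiff_fst.add _root_.contDiff_snd).add (contDiff_bracket.const_smul (1 / 2 : ℝ))

instance : LieGroup 𝓘(ℝ, Heis) ∞ Heis where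
  contMDiff_mul := by
    have h := contDiff_mul.contMDiff
    rwa [modelWithCornersSelf_prod, ← chartedSpaceSelf_prod] at h
  contMDiff_inv := (contDiff_neg : ContDiff ℝ ∞ (fun p : Heis => -p)).contMDiff

instance : IsTopologicalGroup Heis := topologicalGroup_of_lieGroup 𝓘(ℝ, Heis) ∞

instance : LocallyCompactSpace Heis := inferInstanceAs (LocallyCompactSpace (ℝ × ℝ × ℝ))

instance : T2Space Heis := inferInstanceAs (T2Space (ℝ × ℝ × ℝ))

/-- Left translation by `p`, as a diffeomorphism of `H`. -/
def leftTranslation (p : Heis) : Heis ≃ₘ⟮𝓘(ℝ, Heis), 𝓘(ℝ, Heis)⟯ Heis where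
  toEquiv := Equiv.mulLeft p
  contMDiff_toFun := contMDiff_mul_left
  contMDiff_invFun := contMDiff_mul_left

/-- A discrete subgroup acts properly discontinuously by left translations. -/
instance (Γ : Subgroup Heis) [DiscreteTopology Γ] : ProperlyDiscontinuousSMul Γ Heis :=
  Γ.properlyDiscontinuousSMul_of_tendsto_cofinite
    (Γ.tendsto_coe_cofinite_of_discrete (isDiscrete_iff_discreteTopology.mpr inferInstance))

end Heis

open Heis

/-! ### The nilmanifold `Γ \ H` -/

/-- The quotient `Γ \ H` by left translations, with the quotient topology and, when `Γ` is discrete,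
with Mathlib's charted space structure, whose charts are the local inverses of the projection. -/
abbrev Nilmanifold (Γ : Subgroup Heis) : Type := MulAction.orbitRel.Quotient Γ Heis

namespace Nilmanifold

variable (Γ : Subgroup Heis)

/-- The projection `H → Γ \ H`. -/
def proj (p : Heis) : Nilmanifold Γ := Quotient.mk (MulAction.orbitRel Γ Heis) p

theorem proj_surjective : Function.Surjective (proj Γ) := Quotient.mk_surjective

theorem proj_mul (γ : Γ) (p : Heis) : proj Γ ((γ : Heis) * p) = proj Γ p :=
  Quotient.sound ⟨γ, rfl⟩

theorem exists_of_proj_eq {p q : Heis} (h : proj Γ p = proj Γ q) :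
    ∃ γ : Γ, (γ : Heis) * q = p := Quotient.exact h

theorem continuous_proj : Continuous (proj Γ) := continuous_quotient_mk'

variable [DiscreteTopology Γ]

theorem isLocalHomeomorph_proj : IsLocalHomeomorph (proj Γ) :=
  (isQuotientCoveringMap_quotientMk_of_properlyDiscontinuousSMul
    (E := Heis) (G := Γ)).isCoveringMap.isLocalHomeomorph

theorem contDiffAt_localInverseAt_proj (a p : Heis)
    (hp : proj Γ p ∈ ((isLocalHomeomorph_proj Γ).localInverseAt a).source) :
    ContDiffAt ℝ ∞ (fun q : Heis => (isLocalHomeomorph_proj Γ).localInverseAt a (proj Γ q)) p := by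
  set hf := isLocalHomeomorph_proj Γ
  obtain ⟨γ, hγ⟩ := exists_of_proj_eq Γ (hf.apply_localInverseAt_of_mem hp)
  have hc : ContDiff ℝ ∞ (fun q : Heis => (γ : Heis) * q) :=
    contDiff_mul.comp (contDiff_const.prodMk contDiff_id)
  refine hc.contDiffAt.congr_of_eventuallyEq ?_
  have hmem : (γ : Heis) * p ∈ (hf.localInverseAt a).target := by
    rw [hγ]; exact (hf.localInverseAt a).map_source hp
  filter_upwards [hc.continuous.continuousAt.preimage_mem_nhds
    ((hf.localInverseAt a).open_target.mem_nhds hmem)] with q hq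
  have h1 := (hf.localInverseAt a).right_inv hq
  rw [hf.localInverseAt_symm, proj_mul] at h1
  exact h1

/-- The charts of `Γ \ H` are local inverses of the projection. -/
theorem exists_eq_localInverseAt (e : OpenPartialHomeomorph (Nilmanifold Γ) Heis)
    (he : e ∈ atlas Heis (Nilmanifold Γ)) :
    ∃ a : Heis, e = (isLocalHomeomorph_proj Γ).localInverseAt a := by
  obtain ⟨q, rfl⟩ := he
  refine ⟨_, OpenPartialHomeomorph.trans_refl _⟩

instance : IsManifold 𝓘(ℝ, Heis) ∞ (Nilmanifold Γ) := by
  refine isManifold_of_contDiffOn _ _ _ ?_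
  intro e e' he he'
  obtain ⟨a, rfl⟩ := exists_eq_localInverseAt Γ e he
  obtain ⟨b, rfl⟩ := exists_eq_localInverseAt Γ e' he'
  intro p hp
  have h := contDiffAt_localInverseAt_proj Γ b p
  simp only [mfld_simps, IsLocalHomeomorph.localInverseAt_symm] at hp ⊢
  exact (h hp.2).contDiffWithinAt

theorem contMDiff_proj : ContMDiff 𝓘(ℝ, Heis) 𝓘(ℝ, Heis) ∞ (proj Γ) := by
  intro p
  rw [contMDiffAt_iff_target]
  refine ⟨(continuous_proj Γ).continuousAt, ?_⟩
  obtain ⟨a, ha⟩ := exists_eq_localInverseAt Γ _ (chart_mem_atlas Heis (proj Γ p))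
  have hm := mem_chart_source Heis (proj Γ p)
  rw [ha] at hm
  have h := (contDiffAt_localInverseAt_proj Γ a p hm).contMDiffAt
  rw [extChartAt, ha]
  exact h

theorem contMDiffOn_localInverseAt (a : Heis) :
    ContMDiffOn 𝓘(ℝ, Heis) 𝓘(ℝ, Heis) ∞ ((isLocalHomeomorph_proj Γ).localInverseAt a)
      ((isLocalHomeomorph_proj Γ).localInverseAt a).source := by
  refine fun x hx => ContMDiffAt.contMDiffWithinAt ?_
  obtain ⟨b, hb⟩ := exists_eq_localInverseAt Γ _ (chart_mem_atlas Heis x)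
  have hm := mem_chart_source Heis x
  rw [contMDiffAt_iff_source, extChartAt, hb]
  rw [hb] at hm
  simp only [mfld_simps, IsLocalHomeomorph.localInverseAt_symm]
  rw [contMDiffWithinAt_univ]
  refine (contDiffAt_localInverseAt_proj Γ a _ ?_).contMDiffAt
  rw [IsLocalHomeomorph.apply_localInverseAt_of_mem _ hm]
  exact hx

/-- The projection is a local diffeomorphism. -/
theorem isLocalDiffeomorph_proj : IsLocalDiffeomorph 𝓘(ℝ, Heis) 𝓘(ℝ, Heis) ∞ (proj Γ) := by
  intro p
  have hf := isLocalHomeomorph_proj Γ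
  refine ⟨{ toPartialEquiv := (hf.localInverseAt p).symm.toPartialEquiv
            open_source := (hf.localInverseAt p).symm.open_source
            open_target := (hf.localInverseAt p).symm.open_target
            contMDiffOn_toFun := ?_
            contMDiffOn_invFun := contMDiffOn_localInverseAt Γ p },
    hf.self_mem_localInverseAt_target, ?_⟩
  · refine (contMDiff_proj Γ).contMDiffOn.congr fun q _ => ?_
    exact congrFun (hf.localInverseAt_symm p) q
  · exact fun q _ => (congrFun (hf.localInverseAt_symm p) q).symm

/-- The left-invariant frame at `p`, pushed down to `Γ \ H`: the isomorphism
`u ↦ dπ_p ((L_p)_* u)` from `𝔥` to the tangent space of `Γ \ H` at `π p`. -/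
def frameAt (p : Heis) : Heis ≃L[ℝ] TangentSpace 𝓘(ℝ, Heis) (proj Γ p) :=
  ((leftTranslation p).mfderivToContinuousLinearEquiv (by simp) 1).trans
    ((isLocalDiffeomorph_proj Γ).mfderivToContinuousLinearEquiv (by simp) (leftTranslation p 1))

theorem frameAt_apply (p u : Heis) :
    frameAt Γ p u =
      mfderiv 𝓘(ℝ, Heis) 𝓘(ℝ, Heis) (proj Γ) p (mulInvariantVectorField (I := 𝓘(ℝ, Heis)) u p) := by
  have h : leftTranslation p 1 = p := mul_one p
  change mfderiv 𝓘(ℝ, Heis) 𝓘(ℝ, Heis) (proj Γ) (leftTranslation p 1) _ = _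
  rw [h]
  rfl

theorem frameAt_mul (γ : Γ) (p u : Heis) :
    (frameAt Γ ((γ : Heis) * p) u : Heis) = (frameAt Γ p u : Heis) := by
  have key : ∀ p : Heis, (frameAt Γ p u : Heis) =
      mfderiv 𝓘(ℝ, Heis) 𝓘(ℝ, Heis) (fun q => proj Γ (p * q)) 1 u := by
    intro p
    have h2 : MDifferentiableAt 𝓘(ℝ, Heis) 𝓘(ℝ, Heis) (leftTranslation p) 1 :=
      (leftTranslation p).contMDiff.mdifferentiable (by simp) 1
    have h1 : MDifferentiableAt 𝓘(ℝ, Heis) 𝓘(ℝ, Heis) (proj Γ) (leftTranslation p 1) :=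
      (contMDiff_proj Γ).mdifferentiable (by simp) _
    have := mfderiv_comp (1 : Heis) h1 h2
    exact (congrArg (fun L => L u) this).symm
  rw [key, key]
  have : (fun q => proj Γ ((γ : Heis) * p * q)) = fun q => proj Γ (p * q) := by
    funext q
    rw [mul_assoc, proj_mul]
  have hc : ∀ f f' : Heis → Nilmanifold Γ, f = f' →
      (mfderiv 𝓘(ℝ, Heis) 𝓘(ℝ, Heis) f 1 u : Heis) =
        (mfderiv 𝓘(ℝ, Heis) 𝓘(ℝ, Heis) f' 1 u : Heis) := by
    rintro f _ rfl
    rfl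
  exact hc _ _ this

/-- The global frame `𝔥 → T_x (Γ \ H)` induced by the left-invariant vector fields of `H`. It is
computed at a lift of `x`; by `frame_proj` the choice of the lift does not matter. -/
def frame (x : Nilmanifold Γ) : Heis ≃L[ℝ] TangentSpace 𝓘(ℝ, Heis) x :=
  frameAt Γ (proj_surjective Γ x).choose

theorem frame_proj (p u : Heis) : frame Γ (proj Γ p) u = frameAt Γ p u := by
  obtain ⟨γ, hγ⟩ := exists_of_proj_eq Γ (proj_surjective Γ (proj Γ p)).choose_spec
  refine Eq.trans ?_ (frameAt_mul Γ γ p u)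
  rw [hγ]
  rfl

end Nilmanifold

/-! ### Left-invariant metrics and exact left-invariant magnetic forms

A left-invariant metric on `H` is given by an inner product `g` on `𝔥`, and a left-invariant `1`-form
by a linear functional `θ` on `𝔥`. Left-invariant tensors descend to `Γ \ H`, where they have the same
coefficients in the global frame. -/

namespace Heis

/-- The value on left-invariant fields of `dθ`: `dθ(u, w) = -θ([u, w])`. -/
def exteriorDeriv (θ : Heis →ₗ[ℝ] ℝ) (u w : Heis) : ℝ := -θ (bracket u w)

/-- The magnetic parameter `|B|` of the form `dθ`: writing the restriction of `θ` to the centre as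
`B ζ` with `|ζ| = 1`, this is `|B| = |θ(Z)| / |Z|`. -/
def magneticStrength (g : Heis →ₗ[ℝ] Heis →ₗ[ℝ] ℝ) (θ : Heis →ₗ[ℝ] ℝ) : ℝ :=
  |θ Z| / √(g Z Z)

/-- `g(∇_a b, w)` for left-invariant fields `a, b, w`, where `∇` is the Levi-Civita connection of the
left-invariant metric `g` (Koszul formula). -/
def leviCivita (g : Heis →ₗ[ℝ] Heis →ₗ[ℝ] ℝ) (a b w : Heis) : ℝ :=
  (g (bracket a b) w - g (bracket b w) a + g (bracket w a) b) / 2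

end Heis

namespace Nilmanifold

variable (Γ : Subgroup Heis)

/-- The closed curve `s ↦ π (exp (s log γ))`, `0 ≤ s ≤ 1`, which represents the element `γ` of
`Γ = π₁ (Γ \ H)`. In exponential coordinates, `exp (s log γ)` is `s • γ`. -/
def deckLoop (γ : Γ) : C(UnitAddCircle, Nilmanifold Γ) where
  toFun := Function.Periodic.lift (f := fun s : ℝ => proj Γ (s • (γ : Heis))) (c := 1) <| by
    intro s
    have h : (s + 1) • (γ : Heis) = (γ : Heis) * (s • (γ : Heis)) := by
      ext <;> simp [mul_def] <;> ring
    simp only [h, proj_mul]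
  continuous_toFun := continuous_coinduced_dom.mpr <|
    (continuous_proj Γ).comp (continuous_id.smul continuous_const)

variable {Γ} [DiscreteTopology Γ]

/-- The Riemannian metric on `Γ \ H` induced by the left-invariant metric `g`. -/
def metric (g : Heis →ₗ[ℝ] Heis →ₗ[ℝ] ℝ) (x : Nilmanifold Γ) (v w : TangentSpace 𝓘(ℝ, Heis) x) : ℝ :=
  g ((frame Γ x).symm v) ((frame Γ x).symm w)

/-- The velocity of a curve. -/
def velocity (c : ℝ → Nilmanifold Γ) (t : ℝ) : TangentSpace 𝓘(ℝ, Heis) (c t) :=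
  mfderiv 𝓘(ℝ, ℝ) 𝓘(ℝ, Heis) c t (1 : ℝ)

/-- The speed `|c'(t)|` of a curve. -/
def speed (g : Heis →ₗ[ℝ] Heis →ₗ[ℝ] ℝ) (c : ℝ → Nilmanifold Γ) (t : ℝ) : ℝ :=
  √(metric g (c t) (velocity c t) (velocity c t))

/-- The components of the velocity in the global left-invariant frame. -/
def frameVelocity (c : ℝ → Nilmanifold Γ) (t : ℝ) : Heis := (frame Γ (c t)).symm (velocity c t)

/-- A smooth curve `c` in `Γ \ H` is a magnetic geodesic for the metric `g` and the magnetic form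
`Ω = dθ` if `∇_{c'} c' = F c'`, where `Ω(v, w) = g(F v, w)`. In the global frame, if `u(t)` are the
components of `c'(t)`, the components of `∇_{c'} c'` are `u' + ∇_u u`; the equation is stated by
pairing both sides with every left-invariant field `w`. -/
def IsMagneticGeodesic (g : Heis →ₗ[ℝ] Heis →ₗ[ℝ] ℝ) (θ : Heis →ₗ[ℝ] ℝ) (c : ℝ → Nilmanifold Γ) :
    Prop :=
  ContMDiff 𝓘(ℝ, ℝ) 𝓘(ℝ, Heis) ∞ c ∧
  ∀ (t : ℝ) (w : Heis),
    g (deriv (frameVelocity c) t) w + leviCivita g (frameVelocity c t) (frameVelocity c t) w =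
      exteriorDeriv θ (frameVelocity c t) w

/-- The set `L(C; E)` of lengths of the smoothly closed magnetic geodesics of energy `|c'| = E` in
the free homotopy class `C` of the closed curve `δ`. As usual a period may be any `τ ≠ 0`; the closed
curve is `s ↦ c (s τ)`, `0 ≤ s ≤ 1`, and its length is the integral of the speed over `[0, |τ|]`. -/
def magneticLengths (g : Heis →ₗ[ℝ] Heis →ₗ[ℝ] ℝ) (θ : Heis →ₗ[ℝ] ℝ) (E : ℝ)
    (δ : C(UnitAddCircle, Nilmanifold Γ)) : Set ℝ :=
  {L | ∃ (c : ℝ → Nilmanifold Γ) (τ : ℝ),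
    IsMagneticGeodesic g θ c ∧ (∀ t, speed g c t = E) ∧
    τ ≠ 0 ∧ Function.Periodic c τ ∧
    (∃ ε : C(UnitAddCircle, Nilmanifold Γ),
      (∀ s : ℝ, ε (s : UnitAddCircle) = c (s * τ)) ∧ ε.Homotopic δ) ∧
    L = ∫ t in (0 : ℝ)..|τ|, speed g c t}

/-- `Γ₁ \ H` and `Γ₂ \ H` have the same marked magnetic length spectrum at energy `E`: for some
isomorphism `φ : Γ₁ → Γ₂` one has `L(φ_* C; E) = L(C; E)` for every nontrivial free homotopy class `C`.
These classes are the conjugacy classes of the elements `γ ≠ 1`. -/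
def SameMarkedMagneticLengthSpectrum (g : Heis →ₗ[ℝ] Heis →ₗ[ℝ] ℝ) (θ : Heis →ₗ[ℝ] ℝ) (E : ℝ)
    (Γ₁ Γ₂ : Subgroup Heis) [DiscreteTopology Γ₁] [DiscreteTopology Γ₂] : Prop :=
  ∃ φ : Γ₁ ≃* Γ₂, ∀ γ : Γ₁, γ ≠ 1 →
    magneticLengths g θ E (deckLoop Γ₂ (φ γ)) = magneticLengths g θ E (deckLoop Γ₁ γ)

/-- `Γ₁ \ H` and `Γ₂ \ H`, with the metrics induced by `g`, are isometric Riemannian manifolds. -/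
def AreIsometric (g : Heis →ₗ[ℝ] Heis →ₗ[ℝ] ℝ) (Γ₁ Γ₂ : Subgroup Heis) [DiscreteTopology Γ₁]
    [DiscreteTopology Γ₂] : Prop :=
  ∃ f : Nilmanifold Γ₁ ≃ₘ⟮𝓘(ℝ, Heis), 𝓘(ℝ, Heis)⟯ Nilmanifold Γ₂,
    ∀ (x : Nilmanifold Γ₁) (v w : TangentSpace 𝓘(ℝ, Heis) x),
      metric g (f x) (mfderiv 𝓘(ℝ, Heis) 𝓘(ℝ, Heis) f x v) (mfderiv 𝓘(ℝ, Heis) 𝓘(ℝ, Heis) f x w) =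
        metric g x v w

end Nilmanifold

end

/-!
The noncentral classes alone determine the lattice, up to an isometric automorphism of `H` and
conjugation.

In the left-invariant frame, the velocity `u` of a magnetic geodesic satisfies
`g(u', w) = area(u, w) (g(u, Z) - θ(Z))`, so `g(u, Z)` is conserved and the horizontal part of `u`
rotates at constant speed. The rotation has to be trivial if the curve is to be closed with a nonzero
displacement in `𝔥 / ℝ Z`; hence, in the class of a noncentral `γ`, the closed magnetic geodesics are
projections of `t ↦ p * exp (t u)` with `g(u, Z) = θ(Z)`, and they all have the length
`E |γ| / √(E² - B²)`, where `|γ|` is the norm of `γ` in `𝔥 / ℝ Z` (`magneticLengths_deckLoop`).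

An isomorphism `φ : Γ₁ ≃* Γ₂` respecting the spectra thus preserves the norms in `𝔥 / ℝ Z`
(`quotientForm_map_eq`). By polarization it induces a linear isometry of `𝔥 / ℝ Z`, which extends to
an isometric automorphism `Ψ` of `H` acting by `±1` on the centre (`exists_isometric_automorphism`).
The difference between `φ` and `Ψ` is a real character of `Γ₁`, and such a character is given by a
linear functional on `𝔥 / ℝ Z` (`character_eq_one`), so it is absorbed by an inner automorphism of `H`
(`exists_automorphism_of_quotientForm_eq`). So `φ γ = w Ψ(γ) w⁻¹` for some `w`, and the isometry
`p ↦ w Ψ(p)` of `H` descends to the quotients (`areIsometric_of_automorphism`).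
-/

noncomputable section

open Heis

/-! ### Left-invariant fields in exponential coordinates -/

namespace Heis

/-- The symplectic form on `𝔥 / ℝ Z` for which `[u, w] = (area u w) Z`. -/
def area (u w : Heis) : ℝ := u.1 * w.2.1 - u.2.1 * w.1

theorem bracket_eq_area_smul (u w : Heis) : bracket u w = area u w • Z := by
  ext <;> simp [area]

@[simp] theorem sub_fst (p q : Heis) : (p - q).1 = p.1 - q.1 := rfl
@[simp] theorem sub_snd (p q : Heis) : (p - q).2.1 = p.2.1 - q.2.1 := rfl
@[simp] theorem sub_trd (p q : Heis) : (p - q).2.2 = p.2.2 - q.2.2 := rfl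

/-- The vector `x X + y Y`. -/
def horizontal (x y : ℝ) : Heis := ((x, y, 0) : ℝ × ℝ × ℝ)

@[simp] theorem horizontal_fst (x y : ℝ) : (horizontal x y).1 = x := rfl
@[simp] theorem horizontal_snd (x y : ℝ) : (horizontal x y).2.1 = y := rfl
@[simp] theorem horizontal_trd (x y : ℝ) : (horizontal x y).2.2 = 0 := rfl

/-- The bracket as a continuous linear map in its second argument. -/
def bracketRight (p : Heis) : Heis →L[ℝ] Heis :=
  LinearMap.toContinuousLinearMap
    { toFun := bracket p
      map_add' := fun u w => by ext <;> simp; ring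
      map_smul' := fun a u => by ext <;> simp; ring }

@[simp] theorem bracketRight_apply (p u : Heis) : bracketRight p u = bracket p u := rfl

theorem hasFDerivAt_mul_left (p q : Heis) :
    HasFDerivAt (fun q : Heis => p * q)
      (ContinuousLinearMap.id ℝ Heis + (1 / 2 : ℝ) • bracketRight p) q := by
  have h := ((hasFDerivAt_id (𝕜 := ℝ) q).const_add p).add
    (((bracketRight p).hasFDerivAt (x := q)).const_smul (1 / 2 : ℝ))
  exact h

theorem mulInvariantVectorField_eq (u p : Heis) :
    (mulInvariantVectorField (I := 𝓘(ℝ, Heis)) u p : Heis) = u + (1 / 2 : ℝ) • bracket p u := by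
  change mfderiv 𝓘(ℝ, Heis) 𝓘(ℝ, Heis) (fun q : Heis => p * q) 1 u = _
  rw [mfderiv_eq_fderiv, (hasFDerivAt_mul_left p 1).fderiv]
  rfl

end Heis

/-! ### Lifting curves to `H` -/

namespace Nilmanifold

/-- Closed curves whose lifts are translated by the same `γ` over one period are freely homotopic:
left translations are affine in exponential coordinates, so the straight-line homotopy of the lifts
descends. -/
theorem homotopic_deckLoop {Γ : Subgroup Heis} (γ : Γ) {ε : C(UnitAddCircle, Nilmanifold Γ)} {σ : ℝ → Heis}
    (hσ : Continuous σ) (hε : ∀ s : ℝ, ε (s : UnitAddCircle) = proj Γ (σ s))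
    (h : ∀ s, σ (s + 1) = (γ : Heis) * σ s) : ε.Homotopic (deckLoop Γ γ) := by
  let G : C(ℝ × unitInterval, Nilmanifold Γ) :=
    ⟨fun x => proj Γ ((1 - (x.2 : ℝ)) • σ x.1 + (x.2 : ℝ) • x.1 • (γ : Heis)),
      (continuous_proj Γ).comp (by fun_prop)⟩
  have hper : Function.Periodic (G.curry : ℝ → C(unitInterval, Nilmanifold Γ)) 1 := by
    intro s
    ext r
    change proj Γ _ = proj Γ _
    rw [← proj_mul Γ γ ((1 - (r : ℝ)) • σ s + (r : ℝ) • s • (γ : Heis)), h]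
    congr 1
    ext <;> simp [Heis.mul_def] <;> ring
  let K : C(UnitAddCircle, C(unitInterval, Nilmanifold Γ)) :=
    ⟨hper.lift, continuous_coinduced_dom.mpr G.curry.continuous⟩
  refine ⟨⟨K.uncurry.comp ⟨Prod.swap, continuous_swap⟩, fun x => ?_, fun x => ?_⟩⟩
  · induction x using QuotientAddGroup.induction_on with | _ s
    refine Eq.trans ?_ (hε s).symm
    change proj Γ ((1 - (0 : ℝ)) • σ s + (0 : ℝ) • s • (γ : Heis)) = _
    simp
  · induction x using QuotientAddGroup.induction_on with | _ s
    change proj Γ ((1 - (1 : ℝ)) • σ s + (1 : ℝ) • s • (γ : Heis)) = proj Γ (s • (γ : Heis))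
    simp

variable {Γ : Subgroup Heis} [DiscreteTopology Γ]

/-- The velocity of a projected curve, in the left-invariant frame, computed upstairs. -/
theorem frameVelocity_proj_comp {σ : ℝ → Heis} {t : ℝ} {v : Heis} (hσ : HasDerivAt σ v t) :
    frameVelocity (fun s => proj Γ (σ s)) t = v - (1 / 2 : ℝ) • bracket (σ t) v := by
  unfold frameVelocity
  rw [ContinuousLinearEquiv.symm_apply_eq]
  refine Eq.trans ?_ (frame_proj Γ (σ t) _).symm
  rw [frameAt_apply]
  have h1 : MDifferentiableAt 𝓘(ℝ, Heis) 𝓘(ℝ, Heis) (proj Γ) (σ t) :=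
    (contMDiff_proj Γ).mdifferentiable (by simp) _
  have h2 : HasMFDerivAt 𝓘(ℝ, ℝ) 𝓘(ℝ, Heis) σ t (ContinuousLinearMap.toSpanSingleton ℝ v) :=
    hσ.hasFDerivAt.hasMFDerivAt
  have h3 := (h1.hasMFDerivAt.comp t h2).mfderiv
  unfold velocity
  refine (congrArg (fun L => L (1 : ℝ)) h3).trans ?_
  refine congrArg (mfderiv 𝓘(ℝ, Heis) 𝓘(ℝ, Heis) (proj Γ) (σ t)) ?_
  rw [mulInvariantVectorField_eq]
  refine (one_smul ℝ v).trans ?_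
  ext <;> simp

theorem speed_eq (g : Heis →ₗ[ℝ] Heis →ₗ[ℝ] ℝ) (c : ℝ → Nilmanifold Γ) (t : ℝ) :
    speed g c t = √(g (frameVelocity c t) (frameVelocity c t)) := rfl

/-- A continuous lift of a smooth curve is smooth. -/
theorem contDiff_of_contMDiff_proj {σ : ℝ → Heis} (hσ : Continuous σ)
    (h : ContMDiff 𝓘(ℝ, ℝ) 𝓘(ℝ, Heis) ∞ (fun s => proj Γ (σ s))) : ContDiff ℝ ∞ σ := by
  rw [← contMDiff_iff_contDiff]
  intro t
  have hf := isLocalHomeomorph_proj Γ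
  have hsrc : proj Γ (σ t) ∈ (hf.localInverseAt (σ t)).source :=
    hf.apply_self_mem_localInverseAt_source
  have h1 := ((contMDiffOn_localInverseAt Γ (σ t)).contMDiffAt
    ((hf.localInverseAt (σ t)).open_source.mem_nhds hsrc)).comp t (h t)
  refine h1.congr_of_eventuallyEq ?_
  filter_upwards [hσ.continuousAt.preimage_mem_nhds
    ((hf.localInverseAt (σ t)).open_target.mem_nhds hf.self_mem_localInverseAt_target)] with s hs
  have := (hf.localInverseAt (σ t)).right_inv hs
  rw [hf.localInverseAt_symm] at this
  exact this.symm

theorem isCoveringMap_proj : IsCoveringMap (proj Γ) :=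
  (isQuotientCoveringMap_quotientMk_of_properlyDiscontinuousSMul
    (E := Heis) (G := Γ)).isCoveringMap

/-- A closed curve freely homotopic to `deckLoop Γ γ` lifts to a curve translated by `γ` over one
period: the homotopy is lifted starting from the lift `s ↦ s • γ` of the loop. -/
theorem exists_equivariant_lift (γ : Γ) {ε : C(UnitAddCircle, Nilmanifold Γ)}
    (h : ε.Homotopic (deckLoop Γ γ)) :
    ∃ σ : ℝ → Heis, Continuous σ ∧ (∀ s, proj Γ (σ s) = ε (s : UnitAddCircle)) ∧
      ∀ s, σ (s + 1) = (γ : Heis) * σ s := by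
  obtain ⟨F⟩ := h.symm
  let H : C(unitInterval × ℝ, Nilmanifold Γ) :=
    ⟨fun x => F (x.1, (x.2 : UnitAddCircle)), F.continuous.comp (by
      exact continuous_fst.prodMk ((AddCircle.continuous_mk' (1 : ℝ)).comp continuous_snd))⟩
  let f : C(ℝ, Heis) := ⟨fun s => s • (γ : Heis), by fun_prop⟩
  have H0 : ∀ a, H (0, a) = proj Γ (f a) := fun a => F.apply_zero _
  have cov := isCoveringMap_proj (Γ := Γ)
  let G := cov.liftHomotopy H f H0
  have hG : ∀ x, proj Γ (G x) = H x := fun x => congrFun (cov.liftHomotopy_lifts H f H0) x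
  have hG0 : ∀ s : ℝ, G (0, s) = s • (γ : Heis) := fun s => cov.liftHomotopy_zero H f H0 s
  refine ⟨fun s => G (1, s), by fun_prop, fun s => (hG _).trans (F.apply_one _), fun s => ?_⟩
  have key : (fun t => G (t, s + 1)) = fun t => (γ : Heis) * G (t, s) := by
    refine cov.eq_of_comp_eq (by fun_prop) (by fun_prop) ?_ 0 ?_
    · funext t
      simp only [Function.comp_apply, proj_mul, hG]
      change F (t, ((s + 1 : ℝ) : UnitAddCircle)) = F (t, (s : UnitAddCircle))
      rw [AddCircle.coe_add, AddCircle.coe_period, add_zero]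
    · simp only [hG0]
      ext <;> simp [Heis.mul_def] <;> ring
  exact congrFun key 1

end Nilmanifold

/-! ### The form induced on `𝔥 / ℝ Z` -/

namespace Heis

/-- The metric induced by `g` on `𝔥 / ℝ Z`, as a (degenerate) symmetric form on `𝔥`: it is `g`
evaluated on the components orthogonal to the centre. -/
def quotientForm (g : Heis →ₗ[ℝ] Heis →ₗ[ℝ] ℝ) (u w : Heis) : ℝ :=
  g u w - g u Z * g w Z / g Z Z

theorem area_self (u : Heis) : area u u = 0 := by simp [area]; ring

theorem area_swap (u w : Heis) : area w u = -area u w := by simp [area]; ring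

theorem area_mul_right (u v w : Heis) : area u (v * w) = area u v + area u w := by
  simp [area, mul_def]; ring

theorem area_mul_left (u v w : Heis) : area (u * v) w = area u w + area v w := by
  simp [area, mul_def]; ring

theorem area_smul_right (a : ℝ) (u w : Heis) : area u (a • w) = a * area u w := by
  simp [area]; ring

theorem Z_ne_zero : Z ≠ 0 := fun h => by
  have := congrArg (fun p : Heis => p.2.2) h
  simp at this

theorem eq_add_smul_Z {u w : Heis} (h1 : u.1 = w.1) (h2 : u.2.1 = w.2.1) :
    u = w + (u.2.2 - w.2.2) • Z := by
  ext <;> simp [h1, h2]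

theorem hasDerivAt_fst {σ : ℝ → Heis} {v : Heis} {t : ℝ} (h : HasDerivAt σ v t) :
    HasDerivAt (fun s => (σ s).1) v.1 t :=
  ((ContinuousLinearMap.fst ℝ ℝ (ℝ × ℝ)).hasFDerivAt (x := σ t)).comp_hasDerivAt t h

theorem hasDerivAt_snd {σ : ℝ → Heis} {v : Heis} {t : ℝ} (h : HasDerivAt σ v t) :
    HasDerivAt (fun s => (σ s).2.1) v.2.1 t :=
  (((ContinuousLinearMap.fst ℝ ℝ ℝ).comp
    (ContinuousLinearMap.snd ℝ ℝ (ℝ × ℝ))).hasFDerivAt (x := σ t)).comp_hasDerivAt t h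

theorem eq_of_hasDerivAt_zero {f : ℝ → ℝ} (h : ∀ t, HasDerivAt f 0 t) (s t : ℝ) : f s = f t :=
  is_const_of_deriv_eq_zero (fun t => (h t).differentiableAt) (fun t => (h t).deriv) s t

section Form

variable {g : Heis →ₗ[ℝ] Heis →ₗ[ℝ] ℝ}

theorem hasDerivAt_form {u : ℝ → Heis} {v : Heis} {t : ℝ} (h : HasDerivAt u v t) (w : Heis) :
    HasDerivAt (fun s => g (u s) w) (g v w) t :=
  ((LinearMap.toContinuousLinearMap (g.flip w)).hasFDerivAt (x := u t)).comp_hasDerivAt t h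

/-- The frame form of the magnetic geodesic equation. -/
theorem magnetic_equation_iff (g_symm : ∀ u v : Heis, g u v = g v u) (θ : Heis →ₗ[ℝ] ℝ)
    (a u w : Heis) :
    g a w + leviCivita g u u w = exteriorDeriv θ u w ↔ g a w = area u w * (g u Z - θ Z) := by
  have h : leviCivita g u u w = -(area u w * g u Z) := by
    simp only [leviCivita, bracket_eq_area_smul, area_self, area_swap u w, map_smul,
      LinearMap.smul_apply, smul_eq_mul, g_symm Z u]
    ring
  rw [h, exteriorDeriv, bracket_eq_area_smul, map_smul, smul_eq_mul]
  constructor <;> intro h <;> linarith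

variable (g_symm : ∀ u v : Heis, g u v = g v u) (g_pos : ∀ u : Heis, u ≠ 0 → 0 < g u u)

include g_symm g_pos

theorem quotientForm_congr {u u' w w' : Heis} (h1 : u.1 = u'.1) (h2 : u.2.1 = u'.2.1)
    (h3 : w.1 = w'.1) (h4 : w.2.1 = w'.2.1) : quotientForm g u w = quotientForm g u' w' := by
  have hZ := (g_pos Z Z_ne_zero).ne'
  rw [eq_add_smul_Z h1 h2, eq_add_smul_Z h3 h4]
  simp only [quotientForm, map_add, map_smul, LinearMap.add_apply, LinearMap.smul_apply,
    smul_eq_mul, g_symm Z w']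
  field_simp
  ring

theorem quotientForm_eq_proj (u : Heis) : quotientForm g u u =
    g (u - (g u Z / g Z Z) • Z) (u - (g u Z / g Z Z) • Z) := by
  have hZ := (g_pos Z Z_ne_zero).ne'
  simp only [quotientForm, map_sub, map_smul, LinearMap.sub_apply, LinearMap.smul_apply,
    smul_eq_mul, g_symm Z u]
  field_simp
  ring

theorem quotientForm_pos {u : Heis} (hu : u.1 ≠ 0 ∨ u.2.1 ≠ 0) : 0 < quotientForm g u u := by
  rw [quotientForm_eq_proj g_symm g_pos]
  refine g_pos _ fun h => ?_
  have h1 := congrArg (fun p : Heis => p.1) h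
  have h2 := congrArg (fun p : Heis => p.2.1) h
  simp at h1 h2
  tauto

end Form

end Heis

/-! ### Lengths of closed magnetic geodesics -/

namespace Nilmanifold

variable {Γ : Subgroup Heis} [DiscreteTopology Γ] {g : Heis →ₗ[ℝ] Heis →ₗ[ℝ] ℝ}
  (g_symm : ∀ u v : Heis, g u v = g v u) (g_pos : ∀ u : Heis, u ≠ 0 → 0 < g u u)
  {θ : Heis →ₗ[ℝ] ℝ} {E : ℝ}

include g_symm g_pos

/-- A magnetic geodesic whose lift is translated over one period by an element off the centre has
constant frame velocity `u` with `g(u, Z) = θ(Z)`. The quantity `m = g(u, Z)` is conserved, and so is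
`g(u, w) - (m - θ(Z)) area(σ, w)` for every `w`; comparing its values one period apart shows that
`m = θ(Z)`. -/
theorem frameVelocity_const_of_lift {σ : ℝ → Heis} {τ : ℝ} {γ : Heis}
    (hγ : γ.1 ≠ 0 ∨ γ.2.1 ≠ 0) (hσ : ContDiff ℝ ∞ σ)
    (hc : IsMagneticGeodesic g θ (fun t => proj Γ (σ t)))
    (hper : Function.Periodic (fun t => proj Γ (σ t)) τ) (htr : σ τ = γ * σ 0) :
    ∃ u : Heis, (∀ t, frameVelocity (fun t => proj Γ (σ t)) t = u) ∧ g u Z = θ Z ∧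
      γ.1 = τ * u.1 ∧ γ.2.1 = τ * u.2.1 := by
  set c := fun t => proj Γ (σ t) with hcdef
  set u := frameVelocity c with hudef
  have hσd : ∀ t, HasDerivAt σ (deriv σ t) t := fun t =>
    ((hσ.differentiable (by simp)) t).hasDerivAt
  have hu : ∀ t, u t = deriv σ t - (1 / 2 : ℝ) • bracket (σ t) (deriv σ t) := fun t =>
    frameVelocity_proj_comp (hσd t)
  have hu1 : ∀ t, (deriv σ t).1 = (u t).1 := fun t => by
    rw [hu]; simp
  have hu2 : ∀ t, (deriv σ t).2.1 = (u t).2.1 := fun t => by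
    rw [hu]; simp
  have hud : ∀ t, HasDerivAt u (deriv u t) t := by
    intro t
    have hd : ContDiff ℝ ∞ (deriv σ) := ((contDiff_infty_iff_deriv).1 hσ).2
    have : ContDiff ℝ ∞ u := by
      rw [funext hu]
      exact hd.sub ((contDiff_bracket.comp (hσ.prodMk hd)).const_smul _)
    exact ((this.differentiable (by simp)) t).hasDerivAt
  have hode : ∀ t w, g (deriv u t) w = area (u t) w * (g (u t) Z - θ Z) := fun t w =>
    (magnetic_equation_iff g_symm θ _ _ _).1 (hc.2 t w)
  have huper : u τ = u 0 := by
    have h1 : HasDerivAt (fun s => σ (s + τ)) (deriv σ τ) 0 := by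
      have := hσd (0 + τ)
      rw [zero_add] at this
      exact HasDerivAt.comp_add_const 0 τ (by simpa using this)
    have h2 := frameVelocity_proj_comp (Γ := Γ) h1
    rw [show (fun s => proj Γ (σ (s + τ))) = c from funext hper, zero_add] at h2
    exact (hu τ).trans h2.symm
  have hm : ∀ t, g (u t) Z = g (u 0) Z := fun t => by
    refine eq_of_hasDerivAt_zero (f := fun t => g (u t) Z) (fun t => ?_) t 0
    have := hasDerivAt_form (hud t) (g := g) Z
    rw [hode] at this
    simpa [area] using this
  have hconst : ∀ w, (g (u 0) Z - θ Z) * area γ w = 0 := by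
    intro w
    have := eq_of_hasDerivAt_zero
      (f := fun t => g (u t) w - (g (u 0) Z - θ Z) * area (σ t) w) (fun t => ?_) τ 0
    · simp only [huper, htr, area_mul_left] at this
      linarith
    · have h1 := (((hasDerivAt_fst (hσd t)).mul_const w.2.1).sub
        ((hasDerivAt_snd (hσd t)).mul_const w.1)).const_mul (g (u 0) Z - θ Z)
      refine ((hasDerivAt_form (hud t) w).sub h1).congr_deriv ?_
      rw [hode, hm, hu1, hu2, area]
      ring
  have hb : g (u 0) Z = θ Z := by
    by_contra hne
    have h1 : ∀ w, area γ w = 0 := fun w =>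
      (mul_eq_zero.1 (hconst w)).resolve_left (sub_ne_zero.2 hne)
    have h2 := h1 (horizontal (-γ.2.1) γ.1)
    simp only [area, horizontal_fst, horizontal_snd] at h2
    have : γ.1 = 0 ∧ γ.2.1 = 0 := by
      constructor <;> nlinarith [sq_nonneg γ.1, sq_nonneg γ.2.1]
    tauto
  have hu' : ∀ t, deriv u t = 0 := by
    intro t
    by_contra hne
    -- test the equation with `w = u'`
    have h1 := hode t (deriv u t)
    rw [hm, hb, sub_self, mul_zero] at h1
    exact (g_pos _ hne).ne' h1
  have huc : ∀ t, u t = u 0 := fun t =>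
    is_const_of_deriv_eq_zero (fun t => (hud t).differentiableAt) hu' t 0
  refine ⟨u 0, huc, hb, ?_, ?_⟩
  · have := eq_of_hasDerivAt_zero (f := fun t => (σ t).1 - t * (u 0).1) (fun t => ?_) τ 0
    · rw [htr] at this
      simp [Heis.mul_def] at this
      linarith
    · refine ((hasDerivAt_fst (hσd t)).sub ((hasDerivAt_id t).mul_const _)).congr_deriv ?_
      rw [hu1, huc]; simp
  · have := eq_of_hasDerivAt_zero (f := fun t => (σ t).2.1 - t * (u 0).2.1) (fun t => ?_) τ 0
    · rw [htr] at this
      simp [Heis.mul_def] at this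
      linarith
    · refine ((hasDerivAt_snd (hσd t)).sub ((hasDerivAt_id t).mul_const _)).congr_deriv ?_
      rw [hu2, huc]; simp

omit g_symm in
theorem sq_magneticStrength : magneticStrength g θ ^ 2 = θ Z ^ 2 / g Z Z := by
  rw [magneticStrength, div_pow, sq_abs, Real.sq_sqrt (g_pos Z Z_ne_zero).le]

omit g_symm g_pos in
theorem magneticStrength_nonneg : 0 ≤ magneticStrength g θ := by
  unfold magneticStrength; positivity

theorem eq_of_mem_magneticLengths (hE : magneticStrength g θ < E) (γ : Γ)
    (hγ : (γ : Heis).1 ≠ 0 ∨ (γ : Heis).2.1 ≠ 0) {l : ℝ}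
    (hl : l ∈ magneticLengths g θ E (deckLoop Γ γ)) :
    l = E * √(quotientForm g (γ : Heis) γ / (E ^ 2 - magneticStrength g θ ^ 2)) := by
  obtain ⟨c, τ, hc, hspeed, hτ, hper, ⟨ε, hε, hhom⟩, rfl⟩ := hl
  obtain ⟨σ₀, hσ₀, hlift, htr⟩ := exists_equivariant_lift γ hhom
  have hB := magneticStrength_nonneg (g := g) (θ := θ)
  have hE2 : 0 < E ^ 2 - magneticStrength g θ ^ 2 := by nlinarith
  -- `σ₀` lifts the reparametrized curve `s ↦ c (s τ)`
  let σ : ℝ → Heis := fun t => σ₀ (t / τ)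
  have hcσ : c = fun t => proj Γ (σ t) := by
    funext t
    rw [hlift, hε, div_mul_cancel₀ _ hτ]
  have hσ : ContDiff ℝ ∞ σ :=
    contDiff_of_contMDiff_proj (hσ₀.comp (continuous_id.div_const τ)) (hcσ ▸ hc.1)
  have htr' : σ τ = (γ : Heis) * σ 0 := by
    simpa [σ, div_self hτ] using htr 0
  obtain ⟨u, hu, huZ, h1, h2⟩ := frameVelocity_const_of_lift g_symm g_pos hγ hσ (hcσ ▸ hc)
    (hcσ ▸ hper) htr'
  have huE : g u u = E ^ 2 := by
    have h := hspeed 0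
    rw [speed_eq, hcσ, hu 0] at h
    have hpos : 0 ≤ g u u := by
      by_cases h0 : u = 0
      · simp [h0]
      · exact (g_pos u h0).le
    rw [← h, Real.sq_sqrt hpos]
  have hq : quotientForm g (γ : Heis) γ = τ ^ 2 * (E ^ 2 - magneticStrength g θ ^ 2) := by
    rw [quotientForm_congr (u' := τ • u) (w' := τ • u) g_symm g_pos h1 h2 h1 h2,
      sq_magneticStrength g_pos, ← huE, ← huZ]
    simp only [quotientForm, map_smul, LinearMap.smul_apply, smul_eq_mul]
    ring
  simp only [hspeed, intervalIntegral.integral_const, smul_eq_mul, sub_zero]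
  rw [hq, mul_div_cancel_right₀ _ hE2.ne', Real.sqrt_sq_eq_abs, mul_comm]

/-- The one-parameter family `t ↦ p * exp (t u)` provides a closed magnetic geodesic: `u` is chosen
with `g(u, Z) = θ(Z)`, which makes the curve magnetic, and the base point `p` so that the curve is
translated by `γ` over one period. -/
theorem mem_magneticLengths (hE : magneticStrength g θ < E) (γ : Γ)
    (hγ : (γ : Heis).1 ≠ 0 ∨ (γ : Heis).2.1 ≠ 0) :
    E * √(quotientForm g (γ : Heis) γ / (E ^ 2 - magneticStrength g θ ^ 2)) ∈
      magneticLengths g θ E (deckLoop Γ γ) := by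
  have hB := magneticStrength_nonneg (g := g) (θ := θ)
  have hE0 : 0 < E := hB.trans_lt hE
  have hE2 : 0 < E ^ 2 - magneticStrength g θ ^ 2 := by nlinarith
  have hZ := g_pos Z Z_ne_zero
  have hq := quotientForm_pos g_symm g_pos hγ
  set q : ℝ := quotientForm g (γ : Heis) γ with hqdef
  set τ : ℝ := √(q / (E ^ 2 - magneticStrength g θ ^ 2)) with hτdef
  have hτ : 0 < τ := Real.sqrt_pos.2 (div_pos hq hE2)
  have hτ2 : τ ^ 2 * (E ^ 2 - magneticStrength g θ ^ 2) = q := by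
    rw [hτdef, Real.sq_sqrt (div_pos hq hE2).le, div_mul_cancel₀ _ hE2.ne']
  let u : Heis := τ⁻¹ • (γ : Heis) + ((θ Z - τ⁻¹ * g (γ : Heis) Z) / g Z Z) • Z
  have hu1 : u.1 = τ⁻¹ * (γ : Heis).1 := by simp [u]
  have hu2 : u.2.1 = τ⁻¹ * (γ : Heis).2.1 := by simp [u]
  have huZ : g u Z = θ Z := by
    simp only [u, map_add, map_smul, LinearMap.add_apply, LinearMap.smul_apply, smul_eq_mul]
    field_simp
    ring
  have huu : g u u = E ^ 2 := by
    have h1 : quotientForm g u u = τ⁻¹ ^ 2 * q := by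
      rw [quotientForm_congr (u' := τ⁻¹ • (γ : Heis)) (w' := τ⁻¹ • (γ : Heis))
        g_symm g_pos hu1 hu2 hu1 hu2, hqdef]
      simp only [quotientForm, map_smul, LinearMap.smul_apply, smul_eq_mul]
      ring
    rw [quotientForm, huZ, ← hτ2, sq_magneticStrength g_pos] at h1
    field_simp at h1
    exact mul_left_cancel₀ hZ.ne' (by linarith)
  -- `exp (τ u)` and `γ` differ by `d • Z`; conjugation by `p`, orthogonal to `γ`, corrects this
  let d : ℝ := (γ : Heis).2.2 - τ * u.2.2
  let n : ℝ := (γ : Heis).1 ^ 2 + (γ : Heis).2.1 ^ 2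
  have hn : n ≠ 0 := by
    rcases hγ with h | h <;> positivity
  let p : Heis := horizontal (d / n * (γ : Heis).2.1) (-(d / n * (γ : Heis).1))
  have hp1 : p.1 = d / n * (γ : Heis).2.1 := rfl
  have hp2 : p.2.1 = -(d / n * (γ : Heis).1) := rfl
  have hp3 : p.2.2 = 0 := rfl
  let σ : ℝ → Heis := fun t => p * (t • u)
  have htr : ∀ t, σ (t + τ) = (γ : Heis) * σ t := by
    intro t
    have hd : d / n * n = d := div_mul_cancel₀ _ hn
    have e1 : τ * u.1 = (γ : Heis).1 := by rw [hu1]; field_simp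
    have e2 : τ * u.2.1 = (γ : Heis).2.1 := by rw [hu2]; field_simp
    ext
    · simp [σ, Heis.mul_def, add_mul, e1]; ring
    · simp [σ, Heis.mul_def, add_mul, e2]; ring
    · simp only [σ, Heis.mul_def, add_mul, add_trd, smul_trd, bracket_trd, add_fst, add_snd,
        smul_fst, smul_snd, bracket_fst, bracket_snd, hp3, e1, e2]
      rw [hp1, hp2]
      linear_combination hd + t / 2 * (u.2.1 * e1 - u.1 * e2)
  have hσ : ContDiff ℝ ∞ σ :=
    contDiff_mul.comp (contDiff_const.prodMk (contDiff_id.smul contDiff_const))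
  have hder : ∀ t, HasDerivAt σ (u + (1 / 2 : ℝ) • bracket p u) t := fun t => by
    have := (hasFDerivAt_mul_left p (t • u)).comp_hasDerivAt t ((hasDerivAt_id t).smul_const u)
    refine this.congr_deriv ?_
    ext <;> simp
  have hfv : frameVelocity (fun t => proj Γ (σ t)) = fun _ => u := by
    funext t
    rw [frameVelocity_proj_comp (hder t)]
    ext <;> simp [σ, Heis.mul_def]
    ring
  have hspeed : ∀ t, speed g (fun t => proj Γ (σ t)) t = E := fun t => by
    rw [speed_eq, hfv, huu, Real.sqrt_sq hE0.le]
  have hcper : Function.Periodic (fun t => proj Γ (σ t)) τ := fun t => by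
    simp only [htr, proj_mul]
  have hper1 : Function.Periodic (fun s : ℝ => proj Γ (σ (s * τ))) 1 := fun s => by
    simp only [add_mul, one_mul, htr, proj_mul]
  let ε : C(UnitAddCircle, Nilmanifold Γ) :=
    ⟨hper1.lift, continuous_coinduced_dom.mpr
      ((continuous_proj Γ).comp (hσ.continuous.comp (continuous_mul_const τ)))⟩
  refine ⟨fun t => proj Γ (σ t), τ, ⟨(contMDiff_proj Γ).comp hσ.contMDiff, fun t w => ?_⟩, hspeed,
    hτ.ne', hcper, ⟨ε, fun s => rfl, ?_⟩, ?_⟩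
  · rw [magnetic_equation_iff g_symm, hfv, huZ]
    simp
  · exact homotopic_deckLoop γ (hσ.continuous.comp (continuous_mul_const τ)) (fun s => rfl)
      fun s => by simp only [Function.comp_apply, add_mul, one_mul, htr]
  · simp [hspeed, abs_of_pos hτ, mul_comm]

/-- Off the centre, the length spectrum of a free homotopy class is a single number, determined by
the length of the class in `𝔥 / ℝ Z`. -/
theorem magneticLengths_deckLoop (hE : magneticStrength g θ < E) (γ : Γ)
    (hγ : (γ : Heis).1 ≠ 0 ∨ (γ : Heis).2.1 ≠ 0) :
    magneticLengths g θ E (deckLoop Γ γ) =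
      {E * √(quotientForm g (γ : Heis) γ / (E ^ 2 - magneticStrength g θ ^ 2))} :=
  Set.eq_singleton_iff_unique_mem.2 ⟨mem_magneticLengths g_symm g_pos hE γ hγ,
    fun _ hl => eq_of_mem_magneticLengths g_symm g_pos hE γ hγ hl⟩

end Nilmanifold

/-! ### Lattices -/

namespace Heis

theorem commute_iff (p q : Heis) : p * q = q * p ↔ area p q = 0 := by
  constructor
  · intro h
    have h3 := congrArg (fun r : Heis => r.2.2) h
    simp only [mul_def, add_trd, smul_trd, bracket_trd] at h3
    simp only [area]
    linarith
  · intro h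
    simp only [area] at h
    ext
    · simp [mul_def, add_comm]
    · simp [mul_def, add_comm]
    · simp only [mul_def, add_trd, smul_trd, bracket_trd]
      linarith

theorem zpow_eq_smul (p : Heis) (n : ℤ) : p ^ n = (n : ℝ) • p := by
  induction n using Int.induction_on with
  | zero => simp [one_def]
  | succ n ih => rw [zpow_add_one, ih]; ext <;> simp [mul_def] <;> ring
  | pred n ih => rw [zpow_sub_one, ih]; ext <;> simp [mul_def, inv_def] <;> ring

theorem commutator_eq (p q : Heis) : p * q * p⁻¹ * q⁻¹ = area p q • Z := by
  ext <;> simp [mul_def, inv_def, area]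
  ring

/-- Cramer's rule modulo the centre. -/
theorem fst_eq_cramer {a b : Heis} (hab : area a b ≠ 0) (u : Heis) :
    u.1 = area u b / area a b * a.1 + area a u / area a b * b.1 := by
  field_simp
  simp only [area]
  ring

theorem snd_eq_cramer {a b : Heis} (hab : area a b ≠ 0) (u : Heis) :
    u.2.1 = area u b / area a b * a.2.1 + area a u / area a b * b.2.1 := by
  field_simp
  simp only [area]
  ring

end Heis

namespace Nilmanifold

/-- A cocompact subgroup contains two elements that do not commute: otherwise a nonzero linear
functional on `𝔥 / ℝ Z` vanishes on it, and descends to an unbounded continuous function. -/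
theorem exists_area_ne_zero (Γ : Subgroup Heis) [CompactSpace (Nilmanifold Γ)] :
    ∃ a b : Γ, area a b ≠ 0 := by
  by_contra! H
  obtain ⟨v, hv, hvΓ⟩ : ∃ v : Heis, (v.1 ≠ 0 ∨ v.2.1 ≠ 0) ∧ ∀ γ : Γ, area v γ = 0 := by
    by_cases h : ∃ a : Γ, (a : Heis).1 ≠ 0 ∨ (a : Heis).2.1 ≠ 0
    · obtain ⟨a, ha⟩ := h
      exact ⟨a, ha, H a⟩
    · push Not at h
      exact ⟨horizontal 1 0, Or.inl one_ne_zero, fun γ => by simp [area, h γ]⟩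
  let f : Nilmanifold Γ → ℝ := Quotient.lift (fun p => area v p) (by
    rintro p q ⟨γ, rfl⟩
    exact (area_mul_right v γ q).trans (by rw [hvΓ, zero_add]))
  have hc : Continuous f := continuous_quot_lift _ <| by
    have h1 := contDiff_fst.continuous
    have h2 := contDiff_snd.continuous
    unfold area
    fun_prop
  obtain ⟨M, hM⟩ := (isCompact_range hc).bddAbove
  have hn : 0 < v.1 ^ 2 + v.2.1 ^ 2 := by rcases hv with h | h <;> positivity
  have h := hM ⟨proj Γ (((M + 1) / (v.1 ^ 2 + v.2.1 ^ 2)) • horizontal (-v.2.1) v.1),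
    rfl⟩
  change area v _ ≤ M at h
  rw [area_smul_right, show area v (horizontal (-v.2.1) v.1) = v.1 ^ 2 + v.2.1 ^ 2 by
    simp [area]; ring, div_mul_cancel₀ _ hn.ne'] at h
  linarith

/-- The elements of a cocompact subgroup lying in the centre of `H` are those of its own centre. -/
theorem forall_commute_iff (Γ : Subgroup Heis) [CompactSpace (Nilmanifold Γ)] (γ : Γ) :
    (∀ δ : Γ, γ * δ = δ * γ) ↔ (γ : Heis).1 = 0 ∧ (γ : Heis).2.1 = 0 := by
  have h : ∀ δ : Γ, γ * δ = δ * γ ↔ area γ δ = 0 := fun δ => by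
    rw [← commute_iff, ← Subgroup.coe_mul, ← Subgroup.coe_mul, Subtype.coe_inj]
  simp only [h]
  constructor
  · intro H
    obtain ⟨a, b, hab⟩ := exists_area_ne_zero Γ
    rw [fst_eq_cramer hab γ, snd_eq_cramer hab γ, H b, area_swap γ a, H a]
    simp
  · rintro ⟨h1, h2⟩ δ
    simp [area, h1, h2]

/-- A real character of a discrete subgroup that vanishes on two non-commuting elements `a, b` is
trivial: modulo products of powers of `a`, `b` and their commutator, every element lies in a compact
set, so the character takes finitely many values. -/
theorem character_eq_one {Γ : Subgroup Heis} [DiscreteTopology Γ] (k : Γ →* Multiplicative ℝ)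
    {a b : Γ} (hab : area a b ≠ 0) (ha : k a = 1) (hb : k b = 1) (γ : Γ) : k γ = 1 := by
  let G : ℝ × ℝ × ℝ → Heis := fun x =>
    ((x.1 * (a : Heis).1 + x.2.1 * (b : Heis).1, x.1 * (a : Heis).2.1 + x.2.1 * (b : Heis).2.1,
      x.2.2 * area a b) : ℝ × ℝ × ℝ)
  have hG : Continuous G := by
    change Continuous (fun x : ℝ × ℝ × ℝ => ((x.1 * (a : Heis).1 + x.2.1 * (b : Heis).1,
      x.1 * (a : Heis).2.1 + x.2.1 * (b : Heis).2.1, x.2.2 * area a b) : ℝ × ℝ × ℝ))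
    fun_prop
  have hK : IsCompact (G '' (Set.Icc 0 1 ×ˢ Set.Icc 0 1 ×ˢ Set.Icc 0 1)) :=
    (isCompact_Icc.prod (isCompact_Icc.prod isCompact_Icc)).image hG
  have hfin : {δ : Γ | (δ : Heis) ∈ G '' (Set.Icc 0 1 ×ˢ Set.Icc 0 1 ×ˢ Set.Icc 0 1)}.Finite := by
    have h := Γ.tendsto_coe_cofinite_of_discrete (isDiscrete_iff_discreteTopology.mpr inferInstance)
      hK.compl_mem_cocompact
    rw [Filter.mem_map, Filter.mem_cofinite] at h
    rwa [Set.preimage_compl, compl_compl] at h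
  have hrange : (Set.range k).Finite := by
    refine (hfin.image k).subset ?_
    rintro _ ⟨δ, rfl⟩
    let x := area δ b / area a b
    let y := area a δ / area a b
    let δ' : Γ := a ^ (-⌊x⌋) * b ^ (-⌊y⌋) * δ
    let z := (δ' : Heis).2.2 / area a b
    have h1 : (δ' : Heis).1 = Int.fract x * (a : Heis).1 + Int.fract y * (b : Heis).1 := by
      simp only [δ', Subgroup.coe_mul, Subgroup.coe_zpow, zpow_eq_smul, Int.fract]
      simp only [mul_def, add_fst, smul_fst, bracket_fst, fst_eq_cramer hab δ]
      push_cast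
      ring
    have h2 : (δ' : Heis).2.1 = Int.fract x * (a : Heis).2.1 + Int.fract y * (b : Heis).2.1 := by
      simp only [δ', Subgroup.coe_mul, Subgroup.coe_zpow, zpow_eq_smul, Int.fract]
      simp only [mul_def, add_snd, smul_snd, bracket_snd, snd_eq_cramer hab δ]
      push_cast
      ring
    refine ⟨δ' * (a * b * a⁻¹ * b⁻¹) ^ (-⌊z⌋), ⟨(Int.fract x, Int.fract y, Int.fract z),
      ⟨⟨Int.fract_nonneg _, (Int.fract_lt_one _).le⟩, ⟨Int.fract_nonneg _, (Int.fract_lt_one _).le⟩,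
        ⟨Int.fract_nonneg _, (Int.fract_lt_one _).le⟩⟩, ?_⟩, ?_⟩
    · rw [Subgroup.coe_mul, Subgroup.coe_zpow, show ((a * b * a⁻¹ * b⁻¹ : Γ) : Heis) = area a b • Z from
        commutator_eq _ _, zpow_eq_smul]
      ext
      · simp [G, mul_def, h1]
      · simp [G, mul_def, h2]
      · have hz : (δ' : Heis).2.2 = z * area a b := (div_mul_cancel₀ _ hab).symm
        simp only [G, mul_def, add_trd, smul_trd, bracket_trd, smul_fst, smul_snd, Z_fst, Z_snd,
          Z_trd, hz, Int.fract]
        push_cast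
        ring
    · simp [δ', ha, hb]
  by_contra hne
  refine (Set.infinite_range_of_injective (f := fun n : ℤ => k (γ ^ n)) ?_) (hrange.subset ?_)
  · intro m n h
    have h' := congrArg Multiplicative.toAdd h
    have hne' : (k γ).toAdd ≠ 0 := hne
    simpa [hne'] using h'
  · rintro _ ⟨n, rfl⟩
    exact ⟨_, rfl⟩

end Nilmanifold

/-! ### Isometric automorphisms -/

namespace Heis

variable {g : Heis →ₗ[ℝ] Heis →ₗ[ℝ] ℝ}
  (g_symm : ∀ u v : Heis, g u v = g v u) (g_pos : ∀ u : Heis, u ≠ 0 → 0 < g u u)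

theorem quotientForm_smul_add_smul (g : Heis →ₗ[ℝ] Heis →ₗ[ℝ] ℝ)
    (g_symm : ∀ u v : Heis, g u v = g v u) (a b : Heis) (x y x' y' : ℝ) :
    quotientForm g (x • a + y • b) (x' • a + y' • b) =
      x * x' * quotientForm g a a + (x * y' + y * x') * quotientForm g a b +
        y * y' * quotientForm g b b := by
  simp only [quotientForm, map_add, map_smul, LinearMap.add_apply, LinearMap.smul_apply,
    smul_eq_mul, g_symm b a]
  ring

include g_symm g_pos

theorem quotientForm_eq_cramer {a b : Heis} (hab : area a b ≠ 0) (u w : Heis) :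
    quotientForm g u w =
      area u b / area a b * (area w b / area a b) * quotientForm g a a +
        (area u b / area a b * (area a w / area a b) +
          area a u / area a b * (area w b / area a b)) * quotientForm g a b +
        area a u / area a b * (area a w / area a b) * quotientForm g b b := by
  rw [← quotientForm_smul_add_smul g g_symm]
  exact quotientForm_congr g_symm g_pos (fst_eq_cramer hab u) (snd_eq_cramer hab u)
    (fst_eq_cramer hab w) (snd_eq_cramer hab w)

/-- The Gram determinant of `quotientForm` is a positive constant times the square of `area`. -/
theorem exists_gram_eq : ∃ C : ℝ, 0 < C ∧ ∀ a b : Heis,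
    quotientForm g a a * quotientForm g b b - quotientForm g a b ^ 2 = C * area a b ^ 2 := by
  set X := horizontal 1 0 with hXdef
  set Y := horizontal 0 1 with hYdef
  have hXY : area X Y = 1 := by simp [area, hXdef, hYdef]
  have hX : ∀ u, area u Y = u.1 := fun u => by simp [area, hYdef]
  have hY : ∀ u, area X u = u.2.1 := fun u => by simp [area, hXdef]
  refine ⟨quotientForm g X X * quotientForm g Y Y - quotientForm g X Y ^ 2, ?_, fun a b => ?_⟩
  · have hXX : 0 < quotientForm g X X := quotientForm_pos g_symm g_pos (Or.inl one_ne_zero)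
    have h := quotientForm_pos g_symm g_pos
      (u := (-quotientForm g X Y) • X + quotientForm g X X • Y) (Or.inr (by
        simpa [hXdef, hYdef] using hXX.ne'))
    rw [quotientForm_smul_add_smul g g_symm] at h
    exact pos_of_mul_pos_right (a := quotientForm g X X) (by linarith) hXX.le
  · have hne : area X Y ≠ 0 := by rw [hXY]; exact one_ne_zero
    rw [quotientForm_eq_cramer g_symm g_pos hne a a, quotientForm_eq_cramer g_symm g_pos hne a b,
      quotientForm_eq_cramer g_symm g_pos hne b b]
    simp only [hXY, hX, hY, div_one]
    simp only [area]
    ring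

theorem eq_of_quotientForm_eq {a b u w : Heis} (hab : area a b ≠ 0)
    (h1 : quotientForm g u a = quotientForm g w a) (h2 : quotientForm g u b = quotientForm g w b) :
    u.1 = w.1 ∧ u.2.1 = w.2.1 := by
  have hsub : ∀ v, quotientForm g (u - w) v = quotientForm g u v - quotientForm g w v := fun v => by
    simp only [quotientForm, map_sub, LinearMap.sub_apply]
    ring
  by_contra hne
  have hpos := quotientForm_pos g_symm g_pos (u := u - w) (by
    simp only [sub_fst, sub_snd, sub_ne_zero]
    tauto)
  have hz : quotientForm g (u - w) (u - w) =
      area (u - w) b / area a b * quotientForm g (u - w) a +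
        area a (u - w) / area a b * quotientForm g (u - w) b := by
    rw [quotientForm_congr g_symm g_pos (u := u - w) rfl rfl
      (w' := (area (u - w) b / area a b) • a + (area a (u - w) / area a b) • b)
      (fst_eq_cramer hab _) (snd_eq_cramer hab _)]
    simp only [quotientForm, map_add, map_smul, LinearMap.add_apply, LinearMap.smul_apply,
      smul_eq_mul]
    ring
  rw [hsub a, hsub b, h1, h2, sub_self, sub_self] at hz
  linarith

/-- Two pairs that are bases of `𝔥 / ℝ Z` with the same Gram matrix are related by an isometric
automorphism of `𝔥`: it preserves the orthogonal complement of the centre, and acts on the centre by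
the determinant `±1` of the isometry of `𝔥 / ℝ Z`. -/
theorem exists_isometric_automorphism {a b a' b' : Heis} (hab : area a b ≠ 0)
    (haa : quotientForm g a' a' = quotientForm g a a)
    (hgab : quotientForm g a' b' = quotientForm g a b)
    (hbb : quotientForm g b' b' = quotientForm g b b) :
    ∃ Ψ : Heis ≃L[ℝ] Heis, (∀ u w, Ψ (bracket u w) = bracket (Ψ u) (Ψ w)) ∧
      (∀ u w, g (Ψ u) (Ψ w) = g u w) ∧
      (∀ u w, quotientForm g (Ψ u) (Ψ w) = quotientForm g u w) ∧ (Ψ a).1 = a'.1 ∧ (Ψ a).2.1 = a'.2.1 ∧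
      (Ψ b).1 = b'.1 ∧ (Ψ b).2.1 = b'.2.1 := by
  have hZ := (g_pos Z Z_ne_zero).ne'
  set ε := area a' b' / area a b with hε
  have hε2 : ε ^ 2 = 1 := by
    obtain ⟨C, hC, hG⟩ := exists_gram_eq g_symm g_pos
    have h := hG a' b'
    rw [haa, hgab, hbb, hG a b] at h
    rw [hε, div_pow, ← mul_left_cancel₀ hC.ne' h, div_self (pow_ne_zero 2 hab)]
  let P : Heis → Heis := fun u => u - (g u Z / g Z Z) • Z
  have hPZ : ∀ u, g (P u) Z = 0 := fun u => by
    simp only [P, map_sub, map_smul, LinearMap.sub_apply, LinearMap.smul_apply, smul_eq_mul]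
    field_simp
    ring
  let L : Heis →ₗ[ℝ] Heis :=
    { toFun := fun u => (area u b / area a b) • P a' + (area a u / area a b) • P b' +
        (ε * (g u Z / g Z Z)) • Z
      map_add' := fun u w => by
        ext <;> simp [area] <;> ring
      map_smul' := fun r u => by
        ext <;> simp [area] <;> ring }
  have hL : ∀ u, L u = (area u b / area a b) • P a' + (area a u / area a b) • P b' +
        (ε * (g u Z / g Z Z)) • Z := fun u => rfl
  have hL1 : ∀ u, (L u).1 = area u b / area a b * a'.1 + area a u / area a b * b'.1 := fun u => by
    simp [hL, P]
  have hL2 : ∀ u, (L u).2.1 = area u b / area a b * a'.2.1 + area a u / area a b * b'.2.1 :=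
    fun u => by simp [hL, P]
  have hLZ : ∀ u, g (L u) Z = ε * g u Z := fun u => by
    simp only [hL, map_add, map_smul, LinearMap.add_apply, LinearMap.smul_apply, smul_eq_mul, hPZ]
    field_simp
    ring
  have hLq : ∀ u w, quotientForm g (L u) (L w) = quotientForm g u w := by
    intro u w
    rw [quotientForm_congr g_symm g_pos
      (u' := (area u b / area a b) • a' + (area a u / area a b) • b')
      (w' := (area w b / area a b) • a' + (area a w / area a b) • b')
      (hL1 u) (hL2 u) (hL1 w) (hL2 w), quotientForm_smul_add_smul g g_symm, haa, hgab, hbb,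
      quotientForm_eq_cramer g_symm g_pos hab u w]
  have hLg : ∀ u w, g (L u) (L w) = g u w := by
    intro u w
    have h := hLq u w
    simp only [quotientForm, hLZ] at h
    rw [show ε * g u Z * (ε * g w Z) = ε ^ 2 * (g u Z * g w Z) by ring, hε2, one_mul] at h
    linarith
  have hLarea : ∀ u w, area (L u) (L w) = ε * area u w := by
    intro u w
    rw [area, hL1, hL1, hL2, hL2, hε]
    field_simp
    simp only [area]
    ring
  have hLcentre : L Z = ε • Z := by
    rw [hL, div_self hZ]
    simp [area]
  have hinj : Function.Injective L := by
    rw [injective_iff_map_eq_zero]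
    intro u hu
    by_contra hne
    have := g_pos u hne
    rw [← hLg, hu] at this
    simp at this
  refine ⟨(LinearEquiv.ofInjectiveEndo L hinj).toContinuousLinearEquiv, fun u w => ?_, hLg, hLq,
    ?_, ?_, ?_, ?_⟩
  · change L _ = bracket (L u) (L w)
    rw [bracket_eq_area_smul, bracket_eq_area_smul, map_smul, hLcentre, hLarea, smul_smul, mul_comm]
  · exact (hL1 a).trans (by rw [div_self hab, area_self]; simp)
  · exact (hL2 a).trans (by rw [div_self hab, area_self]; simp)
  · exact (hL1 b).trans (by rw [div_self hab, area_self]; simp)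
  · exact (hL2 b).trans (by rw [div_self hab, area_self]; simp)

end Heis

/-! ### Isometries of nilmanifolds -/

namespace Nilmanifold

/-- The map `Γ₁ \ H → Γ₂ \ H` induced by a map of `H` that intertwines the two actions. -/
def descend {Γ₁ Γ₂ : Subgroup Heis} (F : Heis → Heis) (φ : Γ₁ → Γ₂)
    (h : ∀ (γ : Γ₁) (p : Heis), F ((γ : Heis) * p) = (φ γ : Heis) * F p) :
    Nilmanifold Γ₁ → Nilmanifold Γ₂ :=
  Quotient.lift (fun p => proj Γ₂ (F p)) (by
    rintro p q ⟨γ, rfl⟩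
    exact (congrArg (proj Γ₂) (h γ q)).trans (proj_mul Γ₂ _ _))

theorem descend_proj {Γ₁ Γ₂ : Subgroup Heis} (F : Heis → Heis) (φ : Γ₁ → Γ₂)
    (h : ∀ (γ : Γ₁) (p : Heis), F ((γ : Heis) * p) = (φ γ : Heis) * F p) (p : Heis) :
    descend F φ h (proj Γ₁ p) = proj Γ₂ (F p) := rfl

variable {Γ₁ Γ₂ : Subgroup Heis} [DiscreteTopology Γ₁] [DiscreteTopology Γ₂]

theorem contMDiff_descend {F : Heis → Heis} {φ : Γ₁ → Γ₂}
    (h : ∀ (γ : Γ₁) (p : Heis), F ((γ : Heis) * p) = (φ γ : Heis) * F p) (hF : ContDiff ℝ ∞ F) :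
    ContMDiff 𝓘(ℝ, Heis) 𝓘(ℝ, Heis) ∞ (descend F φ h) := by
  intro x
  obtain ⟨p, rfl⟩ := proj_surjective Γ₁ x
  have hf := isLocalHomeomorph_proj Γ₁
  have hmem := (hf.localInverseAt p).open_source.mem_nhds
    (hf.apply_self_mem_localInverseAt_source (x := p))
  have h1 := (contMDiffOn_localInverseAt Γ₁ p).contMDiffAt hmem
  refine ((((contMDiff_proj Γ₂).comp hF.contMDiff) _).comp _ h1).congr_of_eventuallyEq ?_
  filter_upwards [hmem] with y hy
  simp only [Function.comp_apply]
  rw [← descend_proj F φ h, hf.apply_localInverseAt_of_mem hy]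

variable {g : Heis →ₗ[ℝ] Heis →ₗ[ℝ] ℝ}

/-- An isometric automorphism `Ψ` of `H`, followed by a left translation by `w`, induces an isometry
`Γ₁ \ H → Γ₂ \ H` when `Γ₂ = w Ψ(Γ₁) w⁻¹`. -/
theorem areIsometric_of_automorphism (φ : Γ₁ ≃* Γ₂) (Ψ : Heis ≃L[ℝ] Heis) (w : Heis)
    (hΨ : ∀ u v, Ψ (bracket u v) = bracket (Ψ u) (Ψ v)) (hg : ∀ u v, g (Ψ u) (Ψ v) = g u v)
    (hφ : ∀ γ : Γ₁, (φ γ : Heis) * w = w * Ψ γ) : AreIsometric g Γ₁ Γ₂ := by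
  have hmul : ∀ p q, Ψ (p * q) = Ψ p * Ψ q := fun p q => by
    simp only [Heis.mul_def, map_add, map_smul, hΨ]
  -- the left translation by `w` turns `Ψ` into a map equivariant for `φ`
  let F : Heis → Heis := fun p => w * Ψ p
  let F' : Heis → Heis := fun p => Ψ.symm (w⁻¹ * p)
  have hF : ∀ (γ : Γ₁) (p : Heis), F ((γ : Heis) * p) = (φ γ : Heis) * F p := fun γ p => by
    simp only [F, hmul, ← mul_assoc, hφ]
  have hF' : ∀ (γ : Γ₂) (p : Heis), F' ((γ : Heis) * p) = (φ.symm γ : Heis) * F' p := by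
    intro γ p
    apply Ψ.injective
    have := hφ (φ.symm γ)
    rw [φ.apply_symm_apply] at this
    simp only [F', hmul, ContinuousLinearEquiv.apply_symm_apply]
    rw [← mul_right_inj w, ← mul_assoc w (Ψ _), ← this]
    group
  have hFs : ContDiff ℝ ∞ F := contDiff_mul.comp (contDiff_const.prodMk Ψ.contDiff)
  have hFs' : ContDiff ℝ ∞ F' :=
    Ψ.symm.contDiff.comp (contDiff_mul.comp (contDiff_const.prodMk contDiff_id))
  let f : Nilmanifold Γ₁ ≃ₘ⟮𝓘(ℝ, Heis), 𝓘(ℝ, Heis)⟯ Nilmanifold Γ₂ :=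
    { toFun := descend F φ hF
      invFun := descend F' φ.symm hF'
      left_inv := fun x => by
        obtain ⟨p, rfl⟩ := proj_surjective Γ₁ x
        simp [descend_proj, F, F']
      right_inv := fun x => by
        obtain ⟨p, rfl⟩ := proj_surjective Γ₂ x
        simp [descend_proj, F, F']
      contMDiff_toFun := contMDiff_descend hF hFs
      contMDiff_invFun := contMDiff_descend hF' hFs' }
  -- in the left-invariant frames, the differential of `f` is `Ψ`
  have key : ∀ (x : Nilmanifold Γ₁) (u : Heis),
      mfderiv 𝓘(ℝ, Heis) 𝓘(ℝ, Heis) f x (frame Γ₁ x u) = frame Γ₂ (f x) (Ψ u) := by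
    intro x u
    obtain ⟨p, rfl⟩ := proj_surjective Γ₁ x
    have e1 : frame Γ₁ (proj Γ₁ p) u = mfderiv 𝓘(ℝ, Heis) 𝓘(ℝ, Heis) (proj Γ₁) p
        (mulInvariantVectorField (I := 𝓘(ℝ, Heis)) u p) :=
      (frame_proj Γ₁ p u).trans (frameAt_apply Γ₁ p u)
    have e2 : frame Γ₂ (f (proj Γ₁ p)) (Ψ u) = mfderiv 𝓘(ℝ, Heis) 𝓘(ℝ, Heis) (proj Γ₂) (F p)
        (mulInvariantVectorField (I := 𝓘(ℝ, Heis)) (Ψ u) (F p)) :=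
      (frame_proj Γ₂ (F p) (Ψ u)).trans (frameAt_apply Γ₂ (F p) (Ψ u))
    refine (congrArg _ e1).trans (Eq.trans ?_ e2.symm)
    have hFd : HasFDerivAt F ((ContinuousLinearMap.id ℝ Heis + (1 / 2 : ℝ) • bracketRight w).comp
        (Ψ : Heis →L[ℝ] Heis)) p :=
      (hasFDerivAt_mul_left w (Ψ p)).comp p Ψ.hasFDerivAt
    have d1 := ((f.contMDiff.mdifferentiable (by simp) (proj Γ₁ p)).hasMFDerivAt.comp p
      ((contMDiff_proj Γ₁).mdifferentiable (by simp) p).hasMFDerivAt).mfderiv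
    have d2 := (((contMDiff_proj Γ₂).mdifferentiable (by simp) (F p)).hasMFDerivAt.comp p
      hFd.hasMFDerivAt).mfderiv
    have d3 := congrArg (fun L => L (mulInvariantVectorField (I := 𝓘(ℝ, Heis)) u p))
      (d1.symm.trans d2)
    refine Eq.trans d3 ?_
    refine congrArg (mfderiv 𝓘(ℝ, Heis) 𝓘(ℝ, Heis) (proj Γ₂) (F p)) ?_
    rw [mulInvariantVectorField_eq, mulInvariantVectorField_eq]
    change Ψ (u + (1 / 2 : ℝ) • bracket p u) +
      (1 / 2 : ℝ) • bracket w (Ψ (u + (1 / 2 : ℝ) • bracket p u)) = _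
    simp only [map_add, map_smul, hΨ]
    ext <;> simp [F, Heis.mul_def]
    ring
  refine ⟨f, fun x v v' => ?_⟩
  obtain ⟨u, rfl⟩ := (frame Γ₁ x).surjective v
  obtain ⟨u', rfl⟩ := (frame Γ₁ x).surjective v'
  rw [key, key]
  simp only [metric, ContinuousLinearEquiv.symm_apply_apply, hg]

/-! ### The marked spectrum determines the lattice up to isometry -/

/-- Off the centre this is read off from `magneticLengths_deckLoop`; `φ` matches the central elements
of the two lattices, where the form vanishes. -/
theorem quotientForm_map_eq (g_symm : ∀ u v : Heis, g u v = g v u)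
    (g_pos : ∀ u : Heis, u ≠ 0 → 0 < g u u) {θ : Heis →ₗ[ℝ] ℝ} {E : ℝ}
    [CompactSpace (Nilmanifold Γ₁)] [CompactSpace (Nilmanifold Γ₂)]
    (hE : magneticStrength g θ < E) {φ : Γ₁ ≃* Γ₂}
    (hφ : ∀ γ : Γ₁, γ ≠ 1 →
      magneticLengths g θ E (deckLoop Γ₂ (φ γ)) = magneticLengths g θ E (deckLoop Γ₁ γ)) (γ : Γ₁) :
    quotientForm g (φ γ : Heis) (φ γ) = quotientForm g (γ : Heis) γ := by
  have hcentre : ((φ γ : Heis).1 = 0 ∧ (φ γ : Heis).2.1 = 0) ↔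
      ((γ : Heis).1 = 0 ∧ (γ : Heis).2.1 = 0) := by
    rw [← forall_commute_iff, ← forall_commute_iff, φ.surjective.forall]
    simp only [← map_mul, φ.injective.eq_iff]
  by_cases h0 : (γ : Heis).1 = 0 ∧ (γ : Heis).2.1 = 0
  · obtain ⟨h1, h2⟩ := hcentre.2 h0
    have h1' := h1.trans h0.1.symm
    have h2' := h2.trans h0.2.symm
    exact quotientForm_congr g_symm g_pos h1' h2' h1' h2'
  · have hγ : (γ : Heis).1 ≠ 0 ∨ (γ : Heis).2.1 ≠ 0 := by tauto
    have hφγ : (φ γ : Heis).1 ≠ 0 ∨ (φ γ : Heis).2.1 ≠ 0 := by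
      have := mt hcentre.1 h0
      tauto
    have hne : γ ≠ 1 := by
      rintro rfl
      exact h0 ⟨rfl, rfl⟩
    have h := hφ γ hne
    rw [magneticLengths_deckLoop g_symm g_pos hE _ hγ, magneticLengths_deckLoop g_symm g_pos hE _ hφγ,
      Set.singleton_eq_singleton_iff] at h
    have hB := magneticStrength_nonneg (g := g) (θ := θ)
    have hE0 : 0 < E := hB.trans_lt hE
    have hE2 : 0 < E ^ 2 - magneticStrength g θ ^ 2 := by nlinarith
    have h' := mul_left_cancel₀ hE0.ne' h
    rw [Real.sqrt_inj (div_nonneg (quotientForm_pos g_symm g_pos hφγ).le hE2.le)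
      (div_nonneg (quotientForm_pos g_symm g_pos hγ).le hE2.le)] at h'
    exact (div_left_inj' hE2.ne').1 h'

omit [DiscreteTopology Γ₂] in
/-- An isomorphism of lattices that preserves the form on `𝔥 / ℝ Z` is the restriction of an
isometric automorphism of `H` followed by an inner automorphism. -/
theorem exists_automorphism_of_quotientForm_eq (g_symm : ∀ u v : Heis, g u v = g v u)
    (g_pos : ∀ u : Heis, u ≠ 0 → 0 < g u u) [CompactSpace (Nilmanifold Γ₁)] (φ : Γ₁ ≃* Γ₂)
    (hφ : ∀ γ : Γ₁, quotientForm g (φ γ : Heis) (φ γ) = quotientForm g (γ : Heis) γ) :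
    ∃ (Ψ : Heis ≃L[ℝ] Heis) (w : Heis), (∀ u v, Ψ (bracket u v) = bracket (Ψ u) (Ψ v)) ∧
      (∀ u v, g (Ψ u) (Ψ v) = g u v) ∧ ∀ γ : Γ₁, (φ γ : Heis) * w = w * Ψ γ := by
  have hmul : ∀ p q : Heis, quotientForm g (p * q) (p * q) =
      quotientForm g p p + 2 * quotientForm g p q + quotientForm g q q := fun p q => by
    rw [quotientForm_congr (u' := (1 : ℝ) • p + (1 : ℝ) • q) (w' := (1 : ℝ) • p + (1 : ℝ) • q)
      g_symm g_pos (by simp [Heis.mul_def]) (by simp [Heis.mul_def]) (by simp [Heis.mul_def])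
      (by simp [Heis.mul_def]), quotientForm_smul_add_smul g g_symm]
    ring
  have hpol : ∀ γ δ : Γ₁, quotientForm g (φ γ : Heis) (φ δ) = quotientForm g (γ : Heis) δ := by
    intro γ δ
    have h := hφ (γ * δ)
    rw [map_mul, Subgroup.coe_mul, Subgroup.coe_mul, hmul, hmul, hφ, hφ] at h
    linarith
  obtain ⟨a, b, hab⟩ := exists_area_ne_zero Γ₁
  obtain ⟨C, hC, hG⟩ := exists_gram_eq g_symm g_pos
  have hab' : area (φ a) (φ b) ≠ 0 := by
    have h := hG (φ a) (φ b)
    rw [hpol, hpol, hpol, hG] at h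
    have h' := mul_left_cancel₀ hC.ne' h
    intro h0
    rw [h0] at h'
    exact pow_ne_zero 2 hab (by simpa using h')
  obtain ⟨Ψ, hΨ, hg, hq, ha1, ha2, hb1, hb2⟩ := exists_isometric_automorphism g_symm g_pos hab
    (hpol a a) (hpol a b) (hpol b b)
  have hΨmul : ∀ p q, Ψ (p * q) = Ψ p * Ψ q := fun p q => by
    simp only [Heis.mul_def, map_add, map_smul, hΨ]
  have hmod : ∀ γ : Γ₁, (φ γ : Heis).1 = (Ψ γ).1 ∧ (φ γ : Heis).2.1 = (Ψ γ).2.1 := by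
    refine fun γ => eq_of_quotientForm_eq g_symm g_pos hab' ?_ ?_
    · rw [hpol, ← hq]
      exact quotientForm_congr g_symm g_pos rfl rfl ha1 ha2
    · rw [hpol, ← hq]
      exact quotientForm_congr g_symm g_pos rfl rfl hb1 hb2
  -- `f` is the difference between `φ` and `Ψ`, which lies in the centre; it is a character
  let f : Γ₁ → ℝ := fun γ => (φ γ : Heis).2.2 - (Ψ γ).2.2
  have hf : ∀ γ δ, f (γ * δ) = f γ + f δ := fun γ δ => by
    simp only [f, map_mul, Subgroup.coe_mul, hΨmul]
    simp only [Heis.mul_def, add_trd, smul_trd, bracket_trd, (hmod γ).1, (hmod γ).2, (hmod δ).1,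
      (hmod δ).2]
    ring
  -- `area w (φ ·)` agrees with `f` at `a` and `b`, hence everywhere
  let w : Heis := (f b / area (φ a) (φ b)) • (φ a : Heis) - (f a / area (φ a) (φ b)) • (φ b : Heis)
  have hw : ∀ u, area w u =
      f b / area (φ a) (φ b) * area (φ a) u - f a / area (φ a) (φ b) * area (φ b) u := fun u => by
    simp only [w, area, sub_fst, sub_snd, smul_fst, smul_snd]
    ring
  let k : Γ₁ →* Multiplicative ℝ := MonoidHom.mk' (fun γ => .ofAdd (f γ - area w (φ γ)))
    fun γ δ => by
      rw [← ofAdd_add, hf, map_mul, Subgroup.coe_mul, area_mul_right]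
      congr 1
      ring
  have hka : k a = 1 := by
    change Multiplicative.ofAdd (f a - area w (φ a)) = 1
    rw [hw, area_self, area_swap (φ a) (φ b), ofAdd_eq_one]
    field_simp
    ring
  have hkb : k b = 1 := by
    change Multiplicative.ofAdd (f b - area w (φ b)) = 1
    rw [hw, area_self, ofAdd_eq_one]
    field_simp
    ring
  refine ⟨Ψ, w, hΨ, hg, fun γ => ?_⟩
  have h : f γ - area w (φ γ) = 0 := character_eq_one k hab hka hkb γ
  simp only [f, area, (hmod γ).1, (hmod γ).2] at h
  ext
  · simp only [Heis.mul_def, add_fst, smul_fst, bracket_fst, (hmod γ).1]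
    ring
  · simp only [Heis.mul_def, add_snd, smul_snd, bracket_snd, (hmod γ).2]
    ring
  · simp only [Heis.mul_def, add_trd, smul_trd, bracket_trd, (hmod γ).1, (hmod γ).2]
    linarith

end Nilmanifold

end

theorem mainTheorem4
    (g : Heis →ₗ[ℝ] Heis →ₗ[ℝ] ℝ)
    (g_symm : ∀ u v : Heis, g u v = g v u)
    (g_pos : ∀ u : Heis, u ≠ 0 → 0 < g u u)
    (θ : Heis →ₗ[ℝ] ℝ)
    (Γ₁ Γ₂ : Subgroup Heis)
    [DiscreteTopology Γ₁] [DiscreteTopology Γ₂]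
    [CompactSpace (Nilmanifold Γ₁)] [CompactSpace (Nilmanifold Γ₂)]
    (E : ℝ) (hE : Heis.magneticStrength g θ < E)
    (hspec : Nilmanifold.SameMarkedMagneticLengthSpectrum g θ E Γ₁ Γ₂) :
    Nilmanifold.AreIsometric g Γ₁ Γ₂ := by
  obtain ⟨φ, hφ⟩ := hspec
  obtain ⟨Ψ, w, hΨ, hg, hw⟩ := Nilmanifold.exists_automorphism_of_quotientForm_eq g_symm g_pos φ
    (Nilmanifold.quotientForm_map_eq g_symm g_pos hE hφ)
  exact Nilmanifold.areIsometric_of_automorphism φ Ψ w hΨ hg hw
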